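/- Let $d\ge 1$ and let $X$ be a random vector in $\mathbb R^d$ with Laplace transform $\mathcal L(u)=\mathbb E e^{u\cdot X}\in(0,\infty]$. Assume the Cramér condition: $0$ is an interior point of $\{u\in\mathbb R^d:\mathcal L(u)<\infty\}$. Let $I(v)=\sup_{u\in\mathbb R^d}\big(u\cdot v-\log\mathcal L(u)\big)\in[0,\infty]$, $v\in\mathbb R^d$, be the rate function of $X$. For $h:[0,1]\to\mathbb R^d$ and a finite set $\mathbf t\subset(0,1]$, let $h^{\mathbf t}$ be the continuous piecewise linear function on $[0,1]$ with nodes $\mathbf t\cup\{0,1\}$ such that $h^{\mathbf t}(0)=0$ and $h^{\mathbf t}(s)=h(s)$ for $s\in\mathbf t\cup\{1\}$. Put $$\mathrm{Var}(h)=\sup_{\mathbf t}\int_0^1|(h^{\mathbf t})'(s)|\,ds,\qquad I_D(h)=\sup_{\mathbf t}\int_0^1 I\big((h^{\mathbf t})'(s)\big)\,ds,$$ the suprema being over all finite $\mathbf t\subset(0,1]$. Let $BV[0,1]$ be the set of right-continuous functions $h:[0,1]\to\mathbb R^d$ with left limits and $\mathrm{Var}(h)<\infty$, and equip it with two metrics: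 * $\rho_*(g,h)=\int_0^1|g(s)-h(s)|\,ds+|g(1)-h(1)|$; * $\rho_1'(g,h)=\inf_{\gamma_1,\gamma_2}\sup_{t\in[0,1]}|\gamma_1(t)-\gamma_2(t)|$, where $\gamma_1$, $\gamma_2$ run over the continuous bijections of $[0,1]$ onto $\Gamma'g$, respectively $\Gamma'h$, with $\gamma_1(0)=\gamma_2(0)=(0,0)$. Here $\Gamma'h=\{(t,x):0\le t\le1,\ x\in[h(t-),h(t)]\}\cup(\{0\}\times[0,h(0)])\subset[0,1]\times\mathbb R^d$, where $h(0-):=h(0)$, $[a,b]$ denotes the segment between $a,b\in\mathbb R^d$, and $|\cdot|$ is the Euclidean norm on $\mathbb R^{d+1}$. Let $B\subset BV[0,1]$ be a set whose closures in $(BV[0,1],\rho_1')$ and in $(BV[0,1],\rho_*)$ coincide: $\mathrm{cl}_{\rho_1'}(B)=\mathrm{cl}_{\rho_*}(B)$. Let $B^\varepsilon_{\rho_1'}$ be the open $\varepsilon$-neighbourhood of $B$ in $(BV[0,1],\rho_1')$. Then, with $\inf_\varnothing=+\infty$, $$\inf_{h\in\mathrm{cl}_{\rho_1'}(B)}I_D(h)=\lim_{\varepsilon\to0+}\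 \inf_{h\in B^\varepsilon_{\rho_1'}}I_D(h),$$ and, unless $B$ is empty, the infimum on the left is attained at some $h\in\mathrm{cl}_{\rho_1'}(B)$. -/

import Mathlib

open MeasureTheory Filter Set
open scoped Topology ENNReal unitInterval

/-- The Euclidean space `ℝ^d`. -/
abbrev RVec (d : ℕ) : Type := EuclideanSpace ℝ (Fin d)

section Rate

variable {d : ℕ} {Ω : Type*} [MeasurableSpace Ω]

/-- The Laplace transform `u ↦ 𝔼 exp (u · X)`, with values in `[0, ∞]`. -/
noncomputable def laplaceTransform (P : Measure Ω) (X : Ω → RVec d) (u : RVec d) : ℝ≥0∞ :=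
  ∫⁻ ω, ENNReal.ofReal (Real.exp (inner ℝ u (X ω))) ∂P

/-- The effective domain of the Laplace transform. -/
def laplaceDomain (P : Measure Ω) (X : Ω → RVec d) : Set (RVec d) :=
  {u | laplaceTransform P X u < ⊤}

/-- The cumulant generating function, the logarithm of the Laplace transform, as an extended
real. -/
noncomputable def cumulant (P : Measure Ω) (X : Ω → RVec d) (u : RVec d) : EReal :=
  ENNReal.log (laplaceTransform P X u)

/-- The rate function of `X`: the Legendre–Fenchel transform `v ↦ sup_u (u · v - K u)` of the
cumulant generating function `K`. -/
noncomputable def cramerRate (P : Measure Ω) (X : Ω → RVec d) (v : RVec d) : EReal :=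
  ⨆ u : RVec d, (((inner ℝ u v : ℝ) : EReal) - cumulant P X u)

end Rate

section Paths

variable {d : ℕ}

/-- Càdlàg functions on `[0,1]`: right-continuous, with left limits. At the endpoints the
one-sided conditions that make no sense hold trivially. -/
def IsCadlag (h : I → RVec d) : Prop :=
  ∀ t : I, ContinuousWithinAt h (Ici t) t ∧ ∃ l : RVec d, Tendsto h (𝓝[<] t) (𝓝 l)

/-- The function `h^𝐭` for a finite set `𝐭` of times: the piecewise linear function on `[0,1]` with
nodes `𝐭 ∪ {0, 1}`, which equals `h` at the nodes other than `0` and equals `0` at time `0`.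
Here `a` is the last node before or at time `s`, and `b` is the first node at or after time `s`
(if `s` is a node, then `a = b = s` and the value is that of the node). -/
noncomputable def interpolation (h : I → RVec d) (t : Finset I) (s : ℝ) : RVec d :=
  let nodes : Finset I := insert 0 (insert 1 t)
  let a : I := (nodes.filter (fun x : I => (x : ℝ) ≤ s)).sup id
  let b : I := (nodes.filter (fun x : I => s ≤ (x : ℝ))).inf id
  let h₀ : I → RVec d := Function.update h 0 0
  AffineMap.lineMap (h₀ a) (h₀ b) ((s - a) / ((b : ℝ) - a))

/-- The total variation of `h` (which counts the initial jump from `0` to `h 0`): the supremum over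
finite `𝐭 ⊆ (0,1]` of `∫₀¹ |(h^𝐭)'(s)| ds`. -/
noncomputable def totalVar (h : I → RVec d) : ℝ≥0∞ :=
  ⨆ (t : Finset I) (_ : (0 : I) ∉ t), ∫⁻ s in Icc (0 : ℝ) 1, ‖deriv (interpolation h t) s‖ₑ

/-- The space `BV[0,1]` of càdlàg functions `[0,1] → ℝ^d` of bounded variation. -/
def BV (d : ℕ) : Set (I → RVec d) :=
  {h | IsCadlag h ∧ totalVar h < ⊤}

/-- The functional `I_D` on paths: the supremum over finite `𝐭 ⊆ (0,1]` of
`∫₀¹ I((h^𝐭)'(s)) ds`, where `I` is the rate function of `X`. The rate function is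
non-negative (take `u = 0` in its definition), so that `EReal.toENNReal` only changes its type. -/
noncomputable def pathRate {Ω : Type*} [MeasurableSpace Ω] (P : Measure Ω) (X : Ω → RVec d)
    (h : I → RVec d) : ℝ≥0∞ :=
  ⨆ (t : Finset I) (_ : (0 : I) ∉ t),
    ∫⁻ s in Icc (0 : ℝ) 1, (cramerRate P X (deriv (interpolation h t) s)).toENNReal

/-- The space `ℝ × ℝ^d` of (time, position) pairs with the Euclidean norm. -/
abbrev TimeSpace (d : ℕ) : Type := WithLp 2 (ℝ × RVec d)

/-- The completed graph `Γ h`: all `(t, x)` with `x` on the segment from `h(t-)` to `h(t+)`, where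
`h(0-) = h(0)` and `h(1+) = h(1)` (this is also the convention of `Function.leftLim` and
`Function.rightLim`). -/
def completedGraph (h : I → RVec d) : Set (TimeSpace d) :=
  {p | ∃ (t : I) (x : RVec d), x ∈ segment ℝ (Function.leftLim h t) (Function.rightLim h t) ∧
    p = WithLp.toLp 2 ((t : ℝ), x)}

/-- The modified completed graph `Γ' h`: the completed graph together with the segment from the
origin to `h(0)` at time `0`. -/
def modifiedGraph (h : I → RVec d) : Set (TimeSpace d) :=
  completedGraph h ∪ {p | ∃ x ∈ segment ℝ (0 : RVec d) (h 0), p = WithLp.toLp 2 ((0 : ℝ), x)}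

/-- The parametrizations of the modified completed graph: continuous bijections of `[0,1]` onto
`Γ' h` that start from its initial point `(0, 0)`. -/
def parametrizations (h : I → RVec d) : Set (I → TimeSpace d) :=
  {γ | Continuous γ ∧ BijOn γ univ (modifiedGraph h) ∧ γ 0 = WithLp.toLp 2 ((0 : ℝ), (0 : RVec d))}

/-- The Skorokhod-type metric `ρ₁'`: the least uniform distance between parametrizations of the
modified completed graphs. -/
noncomputable def rhoOne (g h : I → RVec d) : ℝ≥0∞ :=
  ⨅ (γ₁ ∈ parametrizations g) (γ₂ ∈ parametrizations h), ⨆ t : I, edist (γ₁ t) (γ₂ t)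

/-- The metric `ρ_*(g, h) = ∫₀¹ |g(s) - h(s)| ds + |g(1) - h(1)|`. -/
noncomputable def rhoStar (g h : I → RVec d) : ℝ≥0∞ :=
  (∫⁻ s : I, ‖g s - h s‖ₑ) + ‖g 1 - h 1‖ₑ

/-- The open `ε`-neighbourhood in `BV[0,1]` of a set `B` with respect to the metric `ρ`. -/
def nbhdBV (ρ : (I → RVec d) → (I → RVec d) → ℝ≥0∞) (B : Set (I → RVec d)) (ε : ℝ) :
    Set (I → RVec d) :=
  {h | h ∈ BV d ∧ ∃ g ∈ B, ρ h g < ENNReal.ofReal ε}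

/-- The closure in `BV[0,1]` of a set `B` with respect to the metric `ρ`. -/
def closureBV (ρ : (I → RVec d) → (I → RVec d) → ℝ≥0∞) (B : Set (I → RVec d)) :
    Set (I → RVec d) :=
  {h | h ∈ BV d ∧ ∀ ε : ℝ, 0 < ε → ∃ g ∈ B, ρ h g < ENNReal.ofReal ε}

end Paths

/-! ### Interpolation slopes and lower semicontinuity of slope functionals. -/

section Slope

variable {d : ℕ}

/-! This is the direct method. The closure lies in every neighbourhood, so only the lower bound
needs work. Choose near-minimizers `k n` in shrinking neighbourhoods of `B`. By the Cramér condition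
the rate dominates the norm linearly (`exists_linear_le_cramerRate`), so the `k n` have uniformly
bounded variation. A Helly argument along an ultrafilter gives a pointwise limit `f`, and its
right-limit function is càdlàg. Fatou's lemma with slightly shifted nodes
(`slopeFunctional_le_of_tendsto`) carries the bounds on rate and variation over to it.

It remains to place this limit in the closure of `B`. Closeness in `rhoOne` gives pointwise
closeness up to the growth of a variation function over a window of radius `ε`
(`dist_le_of_rhoOne_lt`). Such growth integrates to at most `2 * ε * V`, so the elements of `B` near
`k n` approach the limit in `rhoStar`. The endpoint term is controlled because every parametrization
ends at `(1, h 1)` (`parametrization_one`). Since this compactness yields only a `rhoStar` limit,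
the equality of the two closures is what returns it to the `rhoOne` closure. -/

/-- The supremum over finite sets of nodes of the integral of `F` along the slopes of the
interpolations of `h`. Both `totalVar` and `pathRate` are of this form. -/
noncomputable def slopeFunctional (F : RVec d → ℝ≥0∞) (h : I → RVec d) : ℝ≥0∞ :=
  ⨆ (t : Finset I) (_ : (0 : I) ∉ t), ∫⁻ s in Icc (0 : ℝ) 1, F (deriv (interpolation h t) s)

theorem interpolation_update (h : I → RVec d) (t : Finset I) :
    interpolation (Function.update h 0 0) t = interpolation h t := by
  funext s
  simp only [interpolation, Function.update_idem]

/-- Interpolations pin the value at time 0 to the origin, so all paths may be assumed to start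
there, as the compactness argument requires. -/
theorem slopeFunctional_update (F : RVec d → ℝ≥0∞) (h : I → RVec d) :
    slopeFunctional F (Function.update h 0 0) = slopeFunctional F h := by
  simp only [slopeFunctional, interpolation_update]

theorem interpolation_eq_of_adjacent (h : I → RVec d) {t : Finset I} {a b : I} {s : ℝ}
    (ha : a ∈ insert 0 (insert 1 t)) (hb : b ∈ insert 0 (insert 1 t))
    (has : (a : ℝ) < s) (hsb : s < b) (hadj : ∀ x ∈ insert 0 (insert 1 t), x ≤ a ∨ b ≤ x) :
    interpolation h t s = AffineMap.lineMap (Function.update h 0 0 a) (Function.update h 0 0 b)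
      ((s - a) / ((b : ℝ) - a)) := by
  have h1 : (((insert 0 (insert 1 t) : Finset I)).filter (fun x : I => (x : ℝ) ≤ s)).sup id = a := by
    apply le_antisymm
    · refine Finset.sup_le fun x hx => ?_
      obtain ⟨hx, hxs⟩ := Finset.mem_filter.1 hx
      refine (hadj x hx).resolve_right fun hbx => ?_
      have : (b : ℝ) ≤ x := hbx
      linarith
    · exact Finset.le_sup (f := id) (Finset.mem_filter.2 ⟨ha, has.le⟩)
  have h2 : (((insert 0 (insert 1 t) : Finset I)).filter (fun x : I => s ≤ (x : ℝ))).inf id = b := by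
    apply le_antisymm
    · exact Finset.inf_le (f := id) (Finset.mem_filter.2 ⟨hb, hsb.le⟩)
    · refine Finset.le_inf fun x hx => ?_
      obtain ⟨hx, hxs⟩ := Finset.mem_filter.1 hx
      refine (hadj x hx).resolve_left fun hbx => ?_
      have : (x : ℝ) ≤ a := hbx
      linarith
  simp only [interpolation, h1, h2]

theorem deriv_interpolation (h : I → RVec d) {t : Finset I} {a b : I} {s : ℝ}
    (ha : a ∈ insert 0 (insert 1 t)) (hb : b ∈ insert 0 (insert 1 t))
    (has : (a : ℝ) < s) (hsb : s < b) (hadj : ∀ x ∈ insert 0 (insert 1 t), x ≤ a ∨ b ≤ x) :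
    deriv (interpolation h t) s =
      ((b : ℝ) - a)⁻¹ • (Function.update h 0 0 b - Function.update h 0 0 a) := by
  have hev : interpolation h t =ᶠ[𝓝 s] fun r : ℝ =>
      AffineMap.lineMap (Function.update h 0 0 a) (Function.update h 0 0 b)
        ((r - a) / ((b : ℝ) - a)) := by
    filter_upwards [Ioo_mem_nhds has hsb] with r hr
    exact interpolation_eq_of_adjacent h ha hb hr.1 hr.2 hadj
  rw [hev.deriv_eq]
  have h1 : HasDerivAt (fun r : ℝ => (r - a) / ((b : ℝ) - a)) (1 / ((b : ℝ) - a)) s :=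
    ((hasDerivAt_id s).sub_const _).div_const _
  have h2 := (AffineMap.hasDerivAt_lineMap (a := Function.update h 0 0 a)
    (b := Function.update h 0 0 b) (x := (s - a) / ((b : ℝ) - a))).scomp s h1
  rw [one_div] at h2
  exact h2.deriv

theorem exists_adjacent_nodes {N : Finset I} (h0 : 0 ∈ N) (h1 : 1 ∈ N) {s : ℝ}
    (hs : s ∈ Icc (0 : ℝ) 1) (hsN : ∀ x ∈ N, (x : ℝ) ≠ s) :
    ∃ a ∈ N, ∃ b ∈ N, (a : ℝ) < s ∧ s < b ∧ ∀ x ∈ N, x ≤ a ∨ b ≤ x := by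
  have hA : (N.filter fun x : I => (x : ℝ) < s).Nonempty :=
    ⟨0, Finset.mem_filter.2 ⟨h0, lt_of_le_of_ne hs.1 (hsN 0 h0)⟩⟩
  have hB : (N.filter fun x : I => s < (x : ℝ)).Nonempty :=
    ⟨1, Finset.mem_filter.2 ⟨h1, lt_of_le_of_ne hs.2 (hsN 1 h1).symm⟩⟩
  obtain ⟨a, ha, ha'⟩ := Finset.exists_max_image _ id hA
  obtain ⟨b, hb, hb'⟩ := Finset.exists_min_image _ id hB
  rw [Finset.mem_filter] at ha hb
  refine ⟨a, ha.1, b, hb.1, ha.2, hb.2, fun x hx => ?_⟩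
  rcases lt_or_gt_of_ne (hsN x hx) with hlt | hgt
  · exact Or.inl (ha' x (Finset.mem_filter.2 ⟨hx, hlt⟩))
  · exact Or.inr (hb' x (Finset.mem_filter.2 ⟨hx, hgt⟩))

theorem lintegral_deriv_interpolation (h : I → RVec d) {t : Finset I} {a b : I} (hab : a < b)
    (ha : a ∈ insert 0 (insert 1 t)) (hb : b ∈ insert 0 (insert 1 t))
    (hadj : ∀ x ∈ insert 0 (insert 1 t), x ≤ a ∨ b ≤ x) :
    ∫⁻ s in Ioo (a : ℝ) b, ‖deriv (interpolation h t) s‖ₑ =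
      edist (Function.update h 0 0 b) (Function.update h 0 0 a) := by
  have hab' : (0 : ℝ) < (b : ℝ) - a := sub_pos.2 hab
  rw [setLIntegral_congr_fun (g := fun _ => ‖((b : ℝ) - a)⁻¹ •
    (Function.update h 0 0 b - Function.update h 0 0 a)‖ₑ) measurableSet_Ioo
    (fun s hs => by simp only [deriv_interpolation h ha hb hs.1 hs.2 hadj])]
  rw [setLIntegral_const, Real.volume_Ioo, enorm_smul, edist_eq_enorm_sub, mul_right_comm,
    ← Real.enorm_of_nonneg hab'.le, ← enorm_mul, inv_mul_cancel₀ hab'.ne', enorm_one, one_mul]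

/-- Using the points of a partition as nodes, the integral of the slope norm over each gap is
exactly the increment. The value at 0 is reset so that the initial jump counts. -/
theorem eVariationOn_update_le_totalVar (h : I → RVec d) :
    eVariationOn (Function.update h 0 0) univ ≤ totalVar h := by
  refine iSup_le fun ⟨n, u, hu, _⟩ => ?_
  dsimp only
  classical
  set t : Finset I := ((Finset.range (n + 1)).image u).erase 0 with ht
  have ht0 : (0 : I) ∉ t := Finset.notMem_erase _ _
  refine le_trans ?_ (le_iSup₂ (f := fun (t : Finset I) (_ : (0 : I) ∉ t) =>
    ∫⁻ s in Icc (0 : ℝ) 1, ‖deriv (interpolation h t) s‖ₑ) t ht0)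
  have hmem : ∀ i ≤ n, u i ∈ insert 0 (insert 1 t) := by
    intro i hi
    by_cases h0 : u i = 0
    · simp [h0]
    · refine Finset.mem_insert_of_mem (Finset.mem_insert_of_mem ?_)
      exact Finset.mem_erase.2 ⟨h0, Finset.mem_image_of_mem _ (Finset.mem_range.2 (by omega))⟩
  have hadj : ∀ i < n, ∀ x ∈ insert 0 (insert 1 t), x ≤ u i ∨ u (i + 1) ≤ x := by
    intro i hi x hx
    rcases Finset.mem_insert.1 hx with rfl | hx
    · exact Or.inl (unitInterval.nonneg' )
    rcases Finset.mem_insert.1 hx with rfl | hx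
    · exact Or.inr (unitInterval.le_one')
    obtain ⟨j, -, rfl⟩ := Finset.mem_image.1 (Finset.mem_of_mem_erase hx)
    rcases le_or_gt j i with hj | hj
    · exact Or.inl (hu hj)
    · exact Or.inr (hu hj)
  have hle : ∀ i ∈ Finset.range n,
      edist (Function.update h 0 0 (u (i + 1))) (Function.update h 0 0 (u i)) ≤
        ∫⁻ s in Ioo (u i : ℝ) (u (i + 1)), ‖deriv (interpolation h t) s‖ₑ := by
    intro i hi
    have hi := Finset.mem_range.1 hi
    rcases (hu (Nat.le_succ i)).eq_or_lt with heq | hlt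
    · simp only [Nat.succ_eq_add_one] at heq
      simp [← heq]
    · exact (lintegral_deriv_interpolation h hlt (hmem i hi.le) (hmem (i + 1) hi) (hadj i hi)).ge
  refine (Finset.sum_le_sum hle).trans ?_
  rw [← lintegral_biUnion_finset]
  · refine lintegral_mono_set ?_
    refine iUnion₂_subset fun i _ s hs => ⟨(u i).2.1.trans hs.1.le, hs.2.le.trans (u (i + 1)).2.2⟩
  · intro i _ j _ hij
    rw [Function.onFun, Set.disjoint_left]
    intro s hs hs'
    have key : ∀ i j : ℕ, i < j → s ∈ Ioo (u i : ℝ) (u (i + 1)) →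
        s ∈ Ioo (u j : ℝ) (u (j + 1)) → False := by
      intro i j hij hs hs'
      have : (u (i + 1) : ℝ) ≤ u j := hu hij
      linarith [hs.2, hs'.1]
    rcases lt_or_gt_of_ne hij with hlt | hlt
    · exact key i j hlt hs hs'
    · exact key j i hlt hs' hs
  · exact fun i _ => measurableSet_Ioo

/-- A map of the unit interval that fixes the endpoints and moves all other points to the right. -/
noncomputable def shiftRight (k : ℕ) (x : I) : I :=
  if x = 0 then 0 else ⟨x + (1 - x) / (k + 2), by
    have h0 := x.2.1
    have h1 := x.2.2
    have : (1 - (x : ℝ)) / (k + 2) ≤ 1 - x :=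
      div_le_self (by linarith) (by linarith [(Nat.cast_nonneg k : (0 : ℝ) ≤ k)])
    have : 0 ≤ (1 - (x : ℝ)) / (k + 2) := div_nonneg (by linarith) (by positivity)
    constructor <;> linarith⟩

theorem shiftRight_zero (k : ℕ) : shiftRight k 0 = 0 := by simp [shiftRight]

theorem coe_shiftRight (k : ℕ) {x : I} (hx : x ≠ 0) :
    (shiftRight k x : ℝ) = x + (1 - x) / (k + 2) := by simp [shiftRight, hx]

theorem shiftRight_one (k : ℕ) : shiftRight k 1 = 1 := by
  ext
  rw [coe_shiftRight k one_ne_zero]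
  simp

theorem le_shiftRight (k : ℕ) (x : I) : x ≤ shiftRight k x := by
  by_cases hx : x = 0
  · rw [hx, shiftRight_zero]
  · change (x : ℝ) ≤ shiftRight k x
    rw [coe_shiftRight k hx]
    have : 0 ≤ (1 - (x : ℝ)) / (k + 2) := div_nonneg (by linarith [x.2.2]) (by positivity)
    linarith

theorem lt_shiftRight (k : ℕ) {x : I} (hx : x ≠ 0) (hx1 : x ≠ 1) : x < shiftRight k x := by
  change (x : ℝ) < shiftRight k x
  rw [coe_shiftRight k hx]
  have h1 : (x : ℝ) < 1 := lt_of_le_of_ne x.2.2 fun h => hx1 (Subtype.ext h)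
  have : 0 < (1 - (x : ℝ)) / (k + 2) := div_pos (by linarith) (by positivity)
  linarith

theorem shiftRight_ne_zero (k : ℕ) {x : I} (hx : x ≠ 0) : shiftRight k x ≠ 0 :=
  ((unitInterval.pos_iff_ne_zero.2 hx).trans_le (le_shiftRight k x)).ne'

theorem monotone_shiftRight (k : ℕ) : Monotone (shiftRight k) := by
  intro x y hxy
  by_cases hx : x = 0
  · rw [hx, shiftRight_zero]; exact unitInterval.nonneg'
  have hy : y ≠ 0 := ((unitInterval.pos_iff_ne_zero.2 hx).trans_le hxy).ne'
  change (shiftRight k x : ℝ) ≤ shiftRight k y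
  rw [coe_shiftRight k hx, coe_shiftRight k hy]
  have hxy' : (x : ℝ) ≤ y := hxy
  have hk : (0 : ℝ) < k + 2 := by positivity
  have h1 : ((y : ℝ) - x) / (k + 2) ≤ y - x :=
    div_le_self (by linarith) (by linarith [(Nat.cast_nonneg k : (0 : ℝ) ≤ k)])
  have h2 : (1 - (x : ℝ)) / (k + 2) = (1 - (y : ℝ)) / (k + 2) + ((y : ℝ) - x) / (k + 2) := by ring
  linarith

theorem tendsto_shiftRight (x : I) : Tendsto (fun k => shiftRight k x) atTop (𝓝 x) := by
  by_cases hx : x = 0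
  · simp [hx, shiftRight_zero]
  rw [tendsto_subtype_rng]
  simp only [coe_shiftRight _ hx]
  have h1 : Tendsto (fun k : ℕ => (k : ℝ) + 2) atTop atTop :=
    tendsto_atTop_add_const_right _ _ tendsto_natCast_atTop_atTop
  simpa using (tendsto_const_nhds (x := (x : ℝ))).add
    ((tendsto_const_nhds (x := 1 - (x : ℝ))).div_atTop h1)

/-- The pointwise limit `f` need not be right-continuous. The value `h x` is therefore reached
through `f` at points strictly to the right of `x`, which is why the nodes are moved by
`shiftRight`; only 0 and 1 stay fixed. Slopes then converge off the nodes, and Fatou applies. -/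
theorem slopeFunctional_le_of_tendsto {F : RVec d → ℝ≥0∞} (hF : LowerSemicontinuous F)
    {ι : Type*} {l : Filter ι} [l.NeBot] {g : ι → I → RVec d} {f h : I → RVec d}
    (hf : ∀ x, x ≠ 0 → Tendsto (fun i => g i x) l (𝓝 (f x)))
    (hh : ∀ x, x ≠ 0 → x ≠ 1 → Tendsto f (𝓝[>] x) (𝓝 (h x))) (h1 : h 1 = f 1) {c : ℝ≥0∞}
    (hc : ∀ᶠ i in l, slopeFunctional F (g i) ≤ c) : slopeFunctional F h ≤ c := by
  classical
  refine iSup₂_le fun t ht => ?_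
  -- A diagonal choice replaces the arbitrary filter by a sequence, as Fatou's lemma requires.
  have hsel : ∀ k : ℕ, ∃ i, slopeFunctional F (g i) ≤ c ∧
      ∀ x ∈ insert 1 t, dist (g i (shiftRight k x)) (f (shiftRight k x)) < 1 / ((k : ℝ) + 1) := by
    intro k
    refine (hc.and ((Filter.eventually_all_finset _).2 fun x hx => ?_)).exists
    have hx0 : x ≠ 0 := by
      rintro rfl
      rcases Finset.mem_insert.1 hx with hx | hx
      · exact zero_ne_one hx
      · exact ht hx
    exact Metric.tendsto_nhds.1 (hf _ (shiftRight_ne_zero k hx0)) _ Nat.one_div_pos_of_nat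
  choose i hi hi' using hsel
  set T : ℕ → Finset I := fun k => t.image (shiftRight k) with hT
  have hT0 : ∀ k, (0 : I) ∉ T k := by
    intro k hk
    obtain ⟨x, hx, hx0⟩ := Finset.mem_image.1 hk
    exact shiftRight_ne_zero k (fun h => ht (h ▸ hx)) hx0
  have hTN : ∀ k, insert 0 (insert 1 (T k)) = (insert 0 (insert 1 t)).image (shiftRight k) := by
    intro k
    simp [hT, Finset.image_insert, shiftRight_zero, shiftRight_one]
  have hconv : ∀ x ∈ insert 0 (insert 1 t), Tendsto
      (fun k => Function.update (g (i k)) 0 0 (shiftRight k x)) atTop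
      (𝓝 (Function.update h 0 0 x)) := by
    intro x hx
    by_cases hx0 : x = 0
    · simp [hx0, shiftRight_zero]
    have hx' : x ∈ insert 1 t := (Finset.mem_insert.1 hx).resolve_left hx0
    simp only [Function.update_of_ne hx0, Function.update_of_ne (shiftRight_ne_zero _ hx0)]
    have hfx : Tendsto (fun k => f (shiftRight k x)) atTop (𝓝 (h x)) := by
      by_cases hx1 : x = 1
      · simp [hx1, shiftRight_one, h1]
      · exact (hh x hx0 hx1).comp (tendsto_nhdsWithin_iff.2
          ⟨tendsto_shiftRight x, Eventually.of_forall fun k => lt_shiftRight k hx0 hx1⟩)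
    refine (tendsto_iff_of_dist ?_).2 hfx
    exact squeeze_zero (fun _ => dist_nonneg) (fun k => (hi' k x hx').le)
      tendsto_one_div_add_atTop_nhds_zero_nat
  have hae : ∀ᵐ s : ℝ, s ∈ Icc (0 : ℝ) 1 → F (deriv (interpolation h t) s) ≤
      liminf (fun k => F (deriv (interpolation (g (i k)) (T k)) s)) atTop := by
    have hnull : ∀ᵐ s : ℝ, s ∉ ((fun x : I => (x : ℝ)) '' ↑(insert 0 (insert 1 t) : Finset I)) :=
      measure_eq_zero_iff_ae_notMem.1
        (((Finset.finite_toSet _).image _).measure_zero volume)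
    filter_upwards [hnull] with s hsN hs
    obtain ⟨a, ha, b, hb, has, hsb, hadj⟩ := exists_adjacent_nodes
      (N := insert 0 (insert 1 t)) (by simp) (by simp) hs (fun x hx h => hsN ⟨x, hx, h⟩)
    have hta : Tendsto (fun k => (shiftRight k a : ℝ)) atTop (𝓝 a) :=
      (continuous_subtype_val.tendsto _).comp (tendsto_shiftRight a)
    have htb : Tendsto (fun k => (shiftRight k b : ℝ)) atTop (𝓝 b) :=
      (continuous_subtype_val.tendsto _).comp (tendsto_shiftRight b)
    have hev : ∀ᶠ k in atTop, ((shiftRight k b : ℝ) - shiftRight k a)⁻¹ •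
        (Function.update (g (i k)) 0 0 (shiftRight k b) -
          Function.update (g (i k)) 0 0 (shiftRight k a)) =
        deriv (interpolation (g (i k)) (T k)) s := by
      filter_upwards [hta.eventually_lt_const has] with k hk
      refine (deriv_interpolation _ ?_ ?_ hk (hsb.trans_le (le_shiftRight k b)) ?_).symm
      · rw [hTN]; exact Finset.mem_image_of_mem _ ha
      · rw [hTN]; exact Finset.mem_image_of_mem _ hb
      · intro x hx
        rw [hTN] at hx
        obtain ⟨y, hy, rfl⟩ := Finset.mem_image.1 hx
        exact (hadj y hy).imp (fun h => monotone_shiftRight k h) (fun h => monotone_shiftRight k h)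
    have hlim : Tendsto (fun k => deriv (interpolation (g (i k)) (T k)) s) atTop
        (𝓝 (deriv (interpolation h t) s)) := by
      rw [deriv_interpolation h ha hb has hsb hadj]
      refine Tendsto.congr' hev (Tendsto.smul ((htb.sub hta).inv₀ ?_)
        ((hconv b hb).sub (hconv a ha)))
      linarith
    exact (hF.le_liminf _).trans hlim.liminf_le_liminf_comp
  refine (lintegral_mono_ae ((ae_restrict_iff' measurableSet_Icc).2 hae)).trans ?_
  refine (lintegral_liminf_le fun k => hF.measurable.comp (measurable_deriv _)).trans ?_
  refine liminf_le_of_le (by isBoundedDefault) fun b hb => ?_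
  obtain ⟨k, hk⟩ := hb.exists
  exact hk.trans ((le_iSup₂ (f := fun (t : Finset I) (_ : (0 : I) ∉ t) =>
    ∫⁻ s in Icc (0 : ℝ) 1, F (deriv (interpolation (g (i k)) t) s)) (T k) (hT0 k)).trans (hi k))

end Slope

/-! ### Variation functions and their windowed increments. -/

section Modulus

/-- A path of variation at most `V` is controlled by the increments of a monotone function with
values in `[0, V]`. -/
theorem exists_monotone_dist_le {E : Type*} [PseudoMetricSpace E] {f : I → E} {V : ℝ}
    (hV : 0 ≤ V) (hf : eVariationOn f univ ≤ ENNReal.ofReal V) :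
    ∃ w : ℝ → ℝ, Monotone w ∧ (∀ t, 0 ≤ w t ∧ w t ≤ V) ∧
      ∀ x y : I, x ≤ y → dist (f x) (f y) ≤ w y - w x := by
  have hfin : ∀ s, eVariationOn f s ≠ ⊤ := fun s =>
    (((eVariationOn.mono f (subset_univ s)).trans hf).trans_lt ENNReal.ofReal_lt_top).ne
  -- The variation up to time `t`, extended to be constant outside `[0,1]` so that `w (t ± ε)`
  -- always makes sense.
  refine ⟨fun t => (eVariationOn f (Iic (projIcc 0 1 zero_le_one t))).toReal, ?_, ?_, ?_⟩
  · intro x y hxy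
    exact ENNReal.toReal_mono (hfin _)
      (eVariationOn.mono f (Iic_subset_Iic.2 (monotone_projIcc _ hxy)))
  · intro t
    exact ⟨ENNReal.toReal_nonneg, ENNReal.toReal_le_of_le_ofReal hV
      ((eVariationOn.mono f (subset_univ _)).trans hf)⟩
  · intro x y hxy
    simp only [projIcc_val]
    have hu : eVariationOn f (Iic y) = eVariationOn f (Iic x) + eVariationOn f (Icc x y) := by
      rw [← eVariationOn.union f (x := x) isGreatest_Iic (isLeast_Icc hxy),
        Iic_union_Icc_eq_Iic hxy]
    have hd : dist (f x) (f y) ≤ (eVariationOn f (Icc x y)).toReal := by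
      rw [dist_edist]
      exact ENNReal.toReal_mono (hfin _)
        (eVariationOn.edist_le f (left_mem_Icc.2 hxy) (right_mem_Icc.2 hxy))
    rw [hu, ENNReal.toReal_add (hfin _) (hfin _)]
    linarith

/-- The two shifted integrals cancel except on windows of length `2 * ε` around 1 and 0; the first
contributes at most `2 * ε * V`, and the second is subtracted. -/
theorem lintegral_increment_le {w : ℝ → ℝ} (hw : Monotone w) {V : ℝ}
    (hV : ∀ t, 0 ≤ w t ∧ w t ≤ V) {ε : ℝ} (hε : 0 ≤ ε) :
    ∫⁻ s : I, ENNReal.ofReal (w (s + ε) - w (s - ε)) ≤ ENNReal.ofReal (2 * ε * V) := by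
  have hint : ∀ a b, IntervalIntegrable w volume a b := fun a b => hw.intervalIntegrable
  have hp : Monotone fun s => w (s + ε) := fun x y hxy => hw (by linarith)
  have hm : Monotone fun s => w (s - ε) := fun x y hxy => hw (by linarith)
  have h1 : ∫⁻ s : I, ENNReal.ofReal (w (s + ε) - w (s - ε)) =
      ∫⁻ s in Icc (0 : ℝ) 1, ENNReal.ofReal (w (s + ε) - w (s - ε)) :=
    lintegral_subtype_comap measurableSet_Icc
      (fun s : ℝ => ENNReal.ofReal (w (s + ε) - w (s - ε)))
  have hp' : IntervalIntegrable (fun s => w (s + ε)) volume 0 1 := hp.intervalIntegrable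
  have hm' : IntervalIntegrable (fun s => w (s - ε)) volume 0 1 := hm.intervalIntegrable
  have h2 : ∫ s in (0 : ℝ)..1, (w (s + ε) - w (s - ε)) ≤ 2 * ε * V := by
    rw [intervalIntegral.integral_sub hp' hm', intervalIntegral.integral_comp_add_right,
      intervalIntegral.integral_comp_sub_right]
    have e1 : ∫ s in (0 + ε)..(1 + ε), w s =
        (∫ s in (0 - ε)..(1 - ε), w s) - (∫ s in (0 - ε)..(0 + ε), w s)
          + ∫ s in (1 - ε)..(1 + ε), w s := by
      have := intervalIntegral.integral_add_adjacent_intervals (hint (0 - ε) (0 + ε))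
        (hint (0 + ε) (1 + ε))
      have := intervalIntegral.integral_add_adjacent_intervals (hint (0 - ε) (1 - ε))
        (hint (1 - ε) (1 + ε))
      linarith
    have e2 : 0 ≤ ∫ s in (0 - ε)..(0 + ε), w s :=
      intervalIntegral.integral_nonneg (by linarith) fun s _ => (hV s).1
    have e3 : ∫ s in (1 - ε)..(1 + ε), w s ≤ ∫ s in (1 - ε)..(1 + ε), V :=
      intervalIntegral.integral_mono_on (by linarith) (hint _ _) (by simp) fun s _ => (hV s).2
    rw [intervalIntegral.integral_const, smul_eq_mul] at e3
    linarith
  rw [h1, setLIntegral_congr Ioc_ae_eq_Icc.symm, ← ofReal_integral_eq_lintegral_ofReal (hp'.sub hm').1]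
  · rw [← intervalIntegral.integral_of_le zero_le_one]
    exact ENNReal.ofReal_le_ofReal h2
  · exact Eventually.of_forall fun s => sub_nonneg.2 (hw (by linarith))

theorem measurable_increment {w : ℝ → ℝ} (hw : Monotone w) (ε : ℝ) :
    Measurable fun s : I => ENNReal.ofReal (w (s + ε) - w (s - ε)) :=
  ENNReal.measurable_ofReal.comp
    ((hw.measurable.comp (measurable_subtype_coe.add_const ε)).sub
      (hw.measurable.comp (measurable_subtype_coe.sub_const ε)))

end Modulus

/-! ### Semicontinuity and growth of the rate function. -/

section Rate

variable {d : ℕ} {Ω : Type*} [MeasurableSpace Ω] (P : Measure Ω) (X : Ω → RVec d)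

theorem lowerSemicontinuous_cramerRate :
    LowerSemicontinuous fun v : RVec d => (cramerRate P X v).toENNReal := by
  refine EReal.continuous_toENNReal.comp_lowerSemicontinuous ?_
    (fun x y h => EReal.toENNReal_le_toENNReal h)
  refine lowerSemicontinuous_iSup fun u => Continuous.lowerSemicontinuous ?_
  -- For an infinite cumulant the difference is constant in `v`; otherwise it is affine.
  induction cumulant P X u with
  | bot =>
    simp only [EReal.coe_sub_bot]
    exact continuous_const
  | top =>
    simp only [EReal.sub_top]
    exact continuous_const
  | coe r =>
    simp only [← EReal.coe_sub]
    exact continuous_coe_real_ereal.comp ((continuous_const.inner continuous_id).sub continuous_const)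

variable {P X}

theorem ofReal_inner_sub_le_cramerRate {u : RVec d} {c : ℝ} (hc : cumulant P X u ≤ c) (v : RVec d) :
    ENNReal.ofReal (inner ℝ u v - c) ≤ (cramerRate P X v).toENNReal := by
  have hr : ENNReal.ofReal (inner ℝ u v - c) =
      ((inner ℝ u v - c : ℝ) : EReal).toENNReal := by
    rw [EReal.toENNReal_of_ne_top (EReal.coe_ne_top _), EReal.toReal_coe]
  rw [hr]
  refine EReal.toENNReal_le_toENNReal ?_
  rw [EReal.coe_sub]
  exact (EReal.sub_le_sub le_rfl hc).trans
    (le_iSup (fun u : RVec d => ((inner ℝ u v : ℝ) : EReal) - cumulant P X u) u)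

/-- Under the Cramér condition the rate function grows at least linearly. -/
theorem exists_linear_le_cramerRate (h0 : (0 : RVec d) ∈ interior (laplaceDomain P X)) :
    ∃ a c : ℝ, 0 ≤ a ∧ 0 ≤ c ∧ ∀ v : RVec d, ‖v‖ₑ ≤
      ENNReal.ofReal a * ((cramerRate P X v).toENNReal + ENNReal.ofReal c) := by
  obtain ⟨r, hr, hball⟩ := Metric.mem_nhds_iff.1 (mem_interior_iff_mem_nhds.1 h0)
  have hdom : ∀ u : RVec d, ‖u‖ < r → ∃ c : ℝ, cumulant P X u ≤ c := by
    intro u hu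
    have hfin : laplaceTransform P X u < ⊤ := hball (by simpa using hu)
    refine ⟨(cumulant P X u).toReal, EReal.le_coe_toReal ?_⟩
    rw [cumulant, ne_eq, ENNReal.log_eq_top_iff]
    exact hfin.ne
  -- Testing the supremum at `± (r / 2)` times each basis vector, where the cumulant is bounded
  -- above, controls every coordinate of `v`.
  set e : Fin d → RVec d := fun i => EuclideanSpace.single i (r / 2) with he
  have hne : ∀ i, ‖e i‖ < r := by
    intro i
    simp only [he, PiLp.norm_single, Real.norm_eq_abs, abs_of_pos (half_pos hr)]
    linarith
  choose c₁ hc₁ using fun i => hdom (e i) (hne i)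
  choose c₂ hc₂ using fun i => hdom (-e i) (by rw [norm_neg]; exact hne i)
  set c : ℝ := ∑ i, (|c₁ i| + |c₂ i|) with hc
  have hci : ∀ i, |c₁ i| + |c₂ i| ≤ c := fun i =>
    Finset.single_le_sum (f := fun i => |c₁ i| + |c₂ i|) (fun i _ => by positivity)
      (Finset.mem_univ i)
  refine ⟨d * (2 / r), c, by positivity, by positivity, fun v => ?_⟩
  set R := (cramerRate P X v).toENNReal with hR
  have hcoord : ∀ i, ENNReal.ofReal (r / 2 * |v i|) ≤ R + ENNReal.ofReal c := by
    intro i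
    have hi : ∀ x y k : ℝ, x = y → |k| ≤ c → ENNReal.ofReal (x - k) ≤ R →
        ENNReal.ofReal y ≤ R + ENNReal.ofReal c := by
      rintro x y k rfl hk hx
      calc ENNReal.ofReal x ≤ ENNReal.ofReal ((x - k) + c) :=
            ENNReal.ofReal_le_ofReal (by linarith [le_abs_self k])
        _ ≤ ENNReal.ofReal (x - k) + ENNReal.ofReal c := ENNReal.ofReal_add_le
        _ ≤ R + ENNReal.ofReal c := by gcongr
    have h1 : inner ℝ (e i) v = r / 2 * v i := by
      simp [he, EuclideanSpace.inner_single_left]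
    rcases le_total 0 (v i) with hv | hv
    · refine hi (inner ℝ (e i) v) _ (c₁ i) ?_ ?_ (ofReal_inner_sub_le_cramerRate (hc₁ i) v)
      · rw [h1, abs_of_nonneg hv]
      · linarith [hci i, abs_nonneg (c₂ i)]
    · refine hi (inner ℝ (-e i) v) _ (c₂ i) ?_ ?_ (ofReal_inner_sub_le_cramerRate (hc₂ i) v)
      · rw [inner_neg_left, h1, abs_of_nonpos hv]; ring
      · linarith [hci i, abs_nonneg (c₁ i)]
  have hnorm : ‖v‖ ≤ ∑ i, |v i| := by
    rw [EuclideanSpace.norm_eq]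
    refine Real.sqrt_le_iff.2 ⟨Finset.sum_nonneg fun i _ => abs_nonneg _, ?_⟩
    simp only [Real.norm_eq_abs]
    exact Finset.sum_sq_le_sq_sum_of_nonneg fun i _ => abs_nonneg _
  calc ‖v‖ₑ = ENNReal.ofReal ‖v‖ := (ofReal_norm v).symm
    _ ≤ ENNReal.ofReal (∑ i, |v i|) := ENNReal.ofReal_le_ofReal hnorm
    _ = ∑ i, ENNReal.ofReal |v i| := ENNReal.ofReal_sum_of_nonneg fun i _ => abs_nonneg _
    _ = ∑ i, ENNReal.ofReal (2 / r) * ENNReal.ofReal (r / 2 * |v i|) := by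
        refine Finset.sum_congr rfl fun i _ => ?_
        rw [← ENNReal.ofReal_mul (by positivity)]
        congr 1
        field_simp
    _ ≤ ∑ i : Fin d, ENNReal.ofReal (2 / r) * (R + ENNReal.ofReal c) :=
        Finset.sum_le_sum fun i _ => by gcongr; exact hcoord i
    _ = ENNReal.ofReal (d * (2 / r)) * (R + ENNReal.ofReal c) := by
        rw [Finset.sum_const, Finset.card_univ, Fintype.card_fin, nsmul_eq_mul, ← mul_assoc,
          ENNReal.ofReal_mul (by positivity), ENNReal.ofReal_natCast]

theorem totalVar_le_pathRate {a c : ℝ}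
    (hac : ∀ v : RVec d, ‖v‖ₑ ≤
      ENNReal.ofReal a * ((cramerRate P X v).toENNReal + ENNReal.ofReal c)) (h : I → RVec d) :
    totalVar h ≤ ENNReal.ofReal a * (pathRate P X h + ENNReal.ofReal c) := by
  refine iSup₂_le fun t ht => ?_
  refine (lintegral_mono fun s => hac _).trans ?_
  rw [lintegral_const_mul' _ _ ENNReal.ofReal_ne_top, lintegral_add_right _ measurable_const]
  have hle := le_iSup₂ (f := fun (t : Finset I) (_ : (0 : I) ∉ t) =>
    ∫⁻ s in Icc (0 : ℝ) 1, (cramerRate P X (deriv (interpolation h t) s)).toENNReal) t ht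
  have hone : ∫⁻ _ in Icc (0 : ℝ) 1, ENNReal.ofReal c = ENNReal.ofReal c := by simp
  rw [hone]
  gcongr
  exact hle

end Rate

/-! ### Parametrizations of the modified graph. -/

section Graph

variable {d : ℕ}

theorem IsCadlag.rightLim_eq {h : I → RVec d} (hh : IsCadlag h) (t : I) :
    Function.rightLim h t = h t := (hh t).1.rightLim_eq

theorem IsCadlag.tendsto_leftLim {h : I → RVec d} (hh : IsCadlag h) (t : I) :
    Tendsto h (𝓝[<] t) (𝓝 (Function.leftLim h t)) := tendsto_leftLim_of_tendsto (hh t).2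

theorem IsCadlag.mem_modifiedGraph_iff {h : I → RVec d} (hh : IsCadlag h) (p : TimeSpace d) :
    p ∈ modifiedGraph h ↔
      (∃ t : I, ∃ x ∈ segment ℝ (Function.leftLim h t) (h t), p = WithLp.toLp 2 ((t : ℝ), x)) ∨
        ∃ x ∈ segment ℝ (0 : RVec d) (h 0), p = WithLp.toLp 2 ((0 : ℝ), x) := by
  simp only [modifiedGraph, completedGraph, mem_union, mem_ofPred_eq, hh.rightLim_eq]

theorem IsCadlag.mem_modifiedGraph {h : I → RVec d} (hh : IsCadlag h) (t : I) :
    WithLp.toLp 2 ((t : ℝ), h t) ∈ modifiedGraph h :=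
  (hh.mem_modifiedGraph_iff _).2 (Or.inl ⟨t, h t, right_mem_segment _ _ _, rfl⟩)

theorem leftLim_zero {E : Type*} [TopologicalSpace E] (h : I → E) : Function.leftLim h 0 = h 0 :=
  leftLim_eq_of_isBot fun _ => unitInterval.nonneg'

/-- A point of the graph that separates a point `p` from the origin also separates it from the
endpoint of any parametrization. -/
theorem parametrization_one_notMem_of_separated {h : I → RVec d} {γ : I → TimeSpace d}
    (hγ : γ ∈ parametrizations h) {p c : TimeSpace d} {U V : Set (TimeSpace d)}
    (hp : p ∈ modifiedGraph h) (hc : c ∈ modifiedGraph h) (hU : IsOpen U) (hV : IsOpen V)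
    (hcov : ∀ z ∈ modifiedGraph h, z ≠ c → z ∈ U ∨ z ∈ V)
    (hdisj : ∀ z ∈ modifiedGraph h, z ∈ U → z ∉ V) (hcV : c ∉ V)
    (h0 : WithLp.toLp 2 ((0 : ℝ), (0 : RVec d)) ∈ U) (hpV : p ∈ V) : γ 1 ∉ U := by
  intro h1
  obtain ⟨hcont, hbij, hγ0⟩ := hγ
  obtain ⟨s, -, rfl⟩ := hbij.surjOn hp
  obtain ⟨r, -, rfl⟩ := hbij.surjOn hc
  -- By injectivity `γ` meets `c` only at `r`. An interval avoiding `r` is thus mapped into `U ∪ V`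
  -- and, being connected, cannot meet both. Were `γ 1` in `U`, both ends 0 and 1 would map into
  -- `U`, and the one on the same side of `r` as `s` would give a contradiction.
  have key : ∀ S : Set I, S.OrdConnected → r ∉ S → (S ∩ γ ⁻¹' U).Nonempty → s ∈ S → False := by
    intro S hS hr hSU hsS
    obtain ⟨x, -, hxU, hxV⟩ := hS.isPreconnected _ _ (hU.preimage hcont) (hV.preimage hcont)
      (fun x hx => hcov _ (hbij.mapsTo (mem_univ x)) fun hxr =>
        hr (hbij.injOn (mem_univ x) (mem_univ r) hxr ▸ hx)) hSU ⟨s, hsS, hpV⟩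
    exact hdisj _ (hbij.mapsTo (mem_univ x)) hxU hxV
  rcases lt_trichotomy r s with hrs | rfl | hsr
  · exact key (Ioi r) ordConnected_Ioi (lt_irrefl r)
      ⟨1, hrs.trans_le unitInterval.le_one', h1⟩ hrs
  · exact hcV hpV
  · exact key (Iio r) ordConnected_Iio (lt_irrefl r)
      ⟨0, (unitInterval.nonneg').trans_lt hsr, by rw [mem_preimage, hγ0]; exact h0⟩ hsr

/-- A monotone function has only countably many discontinuities, and `h` has no jump at a positive
continuity point of `w`. -/
theorem exists_leftLim_eq_of_lt_one {h : I → RVec d} {w : ℝ → ℝ} (hw : Monotone w)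
    (hd : ∀ x y : I, x ≤ y →
      dist (Function.update h 0 0 x) (Function.update h 0 0 y) ≤ w y - w x) {a : I} (ha : a < 1) :
    ∃ t : I, a < t ∧ t < 1 ∧ Function.leftLim h t = h t := by
  have ha' : (a : ℝ) < 1 := ha
  obtain ⟨r, hr, har⟩ := (hw.countable_not_continuousAt.dense_compl ℝ).exists_between ha'
  have hrc : ContinuousAt w r := not_not.1 hr
  have hr0 : 0 < r := a.2.1.trans_lt har.1
  set t : I := ⟨r, hr0.le, har.2.le⟩ with ht
  have ht0 : (0 : I) < t := hr0
  refine ⟨t, har.1, har.2, ContinuousWithinAt.leftLim_eq ?_⟩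
  rw [ContinuousWithinAt, tendsto_iff_dist_tendsto_zero]
  have hlim : Tendsto (fun x : I => w t - w x) (𝓝[≤] t) (𝓝 0) := by
    have h1 : Tendsto (fun x : I => w x) (𝓝 t) (𝓝 (w t)) :=
      hrc.tendsto.comp (continuous_subtype_val.tendsto t)
    simpa using (h1.const_sub (w t)).mono_left nhdsWithin_le_nhds
  refine squeeze_zero' (Eventually.of_forall fun _ => dist_nonneg) ?_ hlim
  filter_upwards [self_mem_nhdsWithin, mem_nhdsWithin_of_mem_nhds (Ioi_mem_nhds ht0)] with x hx hx0
  have := hd x t hx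
  rwa [Function.update_of_ne ht0.ne', Function.update_of_ne (ne_of_gt hx0)] at this

/-- Every parametrization of the modified graph ends at `(1, h 1)`. -/
theorem parametrization_one {h : I → RVec d} (hh : IsCadlag h) {w : ℝ → ℝ} (hw : Monotone w)
    (hd : ∀ x y : I, x ≤ y →
      dist (Function.update h 0 0 x) (Function.update h 0 0 y) ≤ w y - w x)
    {γ : I → TimeSpace d} (hγ : γ ∈ parametrizations h) :
    γ 1 = WithLp.toLp 2 ((1 : ℝ), h 1) := by
  have hfst : Continuous fun z : TimeSpace d => (WithLp.ofLp z).1 :=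
    continuous_fst.comp (WithLp.prod_continuous_ofLp 2 _ _)
  have hsnd : Continuous fun z : TimeSpace d => (WithLp.ofLp z).2 :=
    continuous_snd.comp (WithLp.prod_continuous_ofLp 2 _ _)
  have hp := hh.mem_modifiedGraph 1
  -- An end at an earlier time is excluded by a later time without jump: the graph has a single
  -- point there, which separates it.
  have hlt : ∀ a : I, a < 1 → (WithLp.ofLp (γ 1)).1 ≠ (a : ℝ) := by
    intro a ha hq
    obtain ⟨t, hat, ht1, hlim⟩ := exists_leftLim_eq_of_lt_one hw hd ha
    have ht0 : (0 : ℝ) < t := a.2.1.trans_lt hat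
    refine parametrization_one_notMem_of_separated hγ hp (hh.mem_modifiedGraph t)
      (U := {z | (WithLp.ofLp z).1 < (t : ℝ)}) (V := {z | (t : ℝ) < (WithLp.ofLp z).1})
      (isOpen_lt hfst continuous_const) (isOpen_lt continuous_const hfst) ?_ ?_ ?_ ?_ ?_ ?_
    · intro z hz hzc
      rcases (hh.mem_modifiedGraph_iff z).1 hz with ⟨s, x, hx, rfl⟩ | ⟨x, hx, rfl⟩
      · refine lt_or_gt_of_ne (a := (s : ℝ)) (b := t) fun hst => hzc ?_
        have hst : s = t := Subtype.ext hst
        subst hst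
        rw [hlim, segment_same, mem_singleton_iff] at hx
        rw [hx]
      · exact Or.inl ht0
    · exact fun z _ hz hz' => lt_asymm (a := (WithLp.ofLp z).1) (b := t) hz hz'
    · exact lt_irrefl (t : ℝ)
    · exact ht0
    · exact ht1
    · change (WithLp.ofLp (γ 1)).1 < (t : ℝ)
      rw [hq]
      exact hat
  rcases (hh.mem_modifiedGraph_iff _).1 (hγ.2.1.mapsTo (mem_univ 1)) with
    ⟨s, x, hx, hq⟩ | ⟨x, hx, hq⟩
  swap
  · exact absurd (by rw [hq]; rfl) (hlt 0 zero_lt_one)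
  by_cases hs : s = 1
  swap
  · exact absurd (by rw [hq]) (hlt s (lt_of_le_of_ne unitInterval.le_one' hs))
  subst hs
  set L := Function.leftLim h 1 with hL
  set D := h 1 - L with hD
  obtain ⟨r, hr, rfl⟩ := (segment_eq_image' ℝ L (h 1)) ▸ hx
  dsimp only at hq
  rw [← hD] at hq
  rcases hr.2.eq_or_lt with rfl | hr1
  · rw [hq, one_smul, hD, add_sub_cancel]; rfl
  by_cases hD0 : D = 0
  · rw [hq, hD0, smul_zero, add_zero, ← sub_eq_zero.1 hD0]; rfl
  exfalso
  have hDpos : 0 < ‖D‖ ^ 2 := by positivity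
  -- If the end lies on the last jump but short of `h 1`, the point halfway between the two
  -- separates them. Just before time 1 the graph stays in the half-space `inner ℝ D x ≤ k`, so it
  -- cannot go around.
  set ρ := (1 + r) / 2 with hρ
  set k := inner ℝ D L + ρ * ‖D‖ ^ 2 with hk
  have hin : ∀ a : ℝ, inner ℝ D (L + a • D) = inner ℝ D L + a * ‖D‖ ^ 2 := by
    intro a
    rw [inner_add_right, inner_smul_right, real_inner_self_eq_norm_sq]
  have hh1 : h 1 = L + (1 : ℝ) • D := by simp [hD]
  have hLk : inner ℝ D L < k := by
    have : 0 < ρ * ‖D‖ ^ 2 := mul_pos (by linarith [hr.1]) hDpos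
    linarith
  have hev : ∀ᶠ t in 𝓝[<] (1 : I), inner ℝ D (h t) < k :=
    ((continuous_const.inner continuous_id).tendsto L |>.comp
      (hh.tendsto_leftLim 1)).eventually_lt_const hLk
  obtain ⟨b, hb, hbk⟩ := (mem_nhdsLT_iff_exists_Ioo_subset' (zero_lt_one (α := I))).1 hev
  set K : Set (RVec d) := {x | inner ℝ D x ≤ k} with hK
  have hKc : IsClosed K := isClosed_le (continuous_const.inner continuous_id) continuous_const
  have hKconv : Convex ℝ K := convex_halfSpace_le (innerₛₗ ℝ D).isLinear k
  have hfib : ∀ t : I, b < t → t < 1 → segment ℝ (Function.leftLim h t) (h t) ⊆ K := by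
    intro t hbt ht1
    refine hKconv.segment_subset ?_ (le_of_lt (hbk ⟨hbt, ht1⟩) : inner ℝ D (h t) ≤ k)
    have : (𝓝[<] t).NeBot := nhdsLT_neBot_of_exists_lt ⟨b, hbt⟩
    refine hKc.mem_of_tendsto (hh.tendsto_leftLim t) ?_
    filter_upwards [Ioo_mem_nhdsLT hbt] with x hx
    exact (le_of_lt (hbk ⟨hx.1, hx.2.trans ht1⟩) : inner ℝ D (h x) ≤ k)
  have hc : WithLp.toLp 2 ((1 : ℝ), L + ρ • D) ∈ modifiedGraph h := by
    refine (hh.mem_modifiedGraph_iff _).2 (Or.inl ⟨1, _, ?_, rfl⟩)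
    rw [segment_eq_image']
    exact ⟨ρ, ⟨by linarith [hr.1], by linarith⟩, rfl⟩
  refine parametrization_one_notMem_of_separated hγ hp hc
    (U := {z | (WithLp.ofLp z).1 < 1} ∪ {z | inner ℝ D (WithLp.ofLp z).2 < k})
    (V := {z | (b : ℝ) < (WithLp.ofLp z).1} ∩ {z | k < inner ℝ D (WithLp.ofLp z).2})
    ((isOpen_lt hfst continuous_const).union
      (isOpen_lt (continuous_const.inner hsnd) continuous_const))
    ((isOpen_lt continuous_const hfst).inter
      (isOpen_lt continuous_const (continuous_const.inner hsnd))) ?_ ?_ ?_ ?_ ?_ ?_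
  · intro z hz hzc
    rcases (hh.mem_modifiedGraph_iff z).1 hz with ⟨s, x, hx, rfl⟩ | ⟨x, hx, rfl⟩
    · by_cases hs : s = 1
      · subst hs
        obtain ⟨a, -, rfl⟩ := (segment_eq_image' ℝ L (h 1)) ▸ hx
        have hval : inner ℝ D (L + a • (h 1 - L)) = inner ℝ D L + a * ‖D‖ ^ 2 := hin a
        rcases lt_trichotomy a ρ with hlt | rfl | hgt
        · left; right
          change inner ℝ D (L + a • (h 1 - L)) < k
          rw [hval]
          have := mul_lt_mul_of_pos_right hlt hDpos
          linarith
        · exact absurd rfl hzc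
        · right
          refine ⟨hb, ?_⟩
          change k < inner ℝ D (L + a • (h 1 - L))
          rw [hval]
          have := mul_lt_mul_of_pos_right hgt hDpos
          linarith
      · left; left
        exact lt_of_le_of_ne unitInterval.le_one' hs
    · left; left
      exact zero_lt_one (α := ℝ)
  · rintro z hz (hz1 | hzk) ⟨hbz, hkz⟩
    · rcases (hh.mem_modifiedGraph_iff z).1 hz with ⟨s, x, hx, rfl⟩ | ⟨x, hx, rfl⟩
      · exact not_lt_of_ge (a := inner ℝ D x) (b := k) (hfib s hbz hz1 hx) hkz
      · exact not_lt_of_ge (a := (0 : ℝ)) b.2.1 hbz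
    · exact lt_asymm (a := inner ℝ D (WithLp.ofLp z).2) (b := k) hzk hkz
  · rintro ⟨-, hkz⟩
    change k < inner ℝ D (L + ρ • D) at hkz
    rw [hin] at hkz
    exact lt_irrefl _ hkz
  · exact Or.inl (zero_lt_one (α := ℝ))
  · refine ⟨hb, ?_⟩
    change k < inner ℝ D (h 1)
    rw [hh1, hin]
    have := mul_lt_mul_of_pos_right (show ρ < 1 by linarith) hDpos
    linarith
  · right
    rw [hq]
    change inner ℝ D (L + r • D) < k
    rw [hin]
    have := mul_lt_mul_of_pos_right (show r < ρ by linarith) hDpos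
    linarith

/-- Points of the modified graph at times near `t` are close to `h t`, up to an increment of the
variation. -/
theorem dist_le_of_mem_modifiedGraph {h : I → RVec d} (hh : IsCadlag h) {w : ℝ → ℝ}
    (hw : Monotone w) (hd : ∀ x y : I, x ≤ y →
      dist (Function.update h 0 0 x) (Function.update h 0 0 y) ≤ w y - w x)
    {p : TimeSpace d} (hp : p ∈ modifiedGraph h) {t : I} (ht : t ≠ 0) {ε : ℝ}
    (hε : |(WithLp.ofLp p).1 - t| < ε) :
    dist (WithLp.ofLp p).2 (h t) ≤ w (t + ε) - w (t - ε) := by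
  -- Convexity reduces the claim to the endpoints of the segments. Left limits, and `h 0` as a right
  -- limit, lie in `K` because it is closed.
  set K := Metric.closedBall (h t) (w (t + ε) - w (t - ε)) with hK
  have hball : ∀ y : I, |(y : ℝ) - t| < ε → Function.update h 0 0 y ∈ K := by
    intro y hy
    rw [abs_lt] at hy
    rw [hK, Metric.mem_closedBall, ← Function.update_of_ne ht (0 : RVec d) h]
    have e1 : w y ≤ w (t + ε) := hw (by linarith)
    have e2 : w t ≤ w (t + ε) := hw (by linarith)
    have e3 : w (t - ε) ≤ w y := hw (by linarith)
    have e4 : w (t - ε) ≤ w t := hw (by linarith)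
    rcases le_total y t with hyt | hyt
    · exact (hd y t hyt).trans (by linarith)
    · rw [dist_comm]
      exact (hd t y hyt).trans (by linarith)
  have hnear : ∀ u : I, |(u : ℝ) - t| < ε → ∀ᶠ y : I in 𝓝 u, |(y : ℝ) - t| < ε := fun u hu =>
    (continuous_subtype_val.sub continuous_const).abs.continuousAt.eventually_lt
      continuousAt_const hu
  have hval : ∀ u : I, |(u : ℝ) - t| < ε → h u ∈ K := by
    intro u hu
    by_cases hu0 : u = 0
    · subst hu0
      have hlim : Tendsto h (𝓝[>] (0 : I)) (𝓝 (h 0)) :=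
        (hh 0).1.tendsto.mono_left (nhdsWithin_mono _ Ioi_subset_Ici_self)
      have : (𝓝[>] (0 : I)).NeBot := nhdsGT_neBot_of_exists_gt ⟨1, zero_lt_one⟩
      refine Metric.isClosed_closedBall.mem_of_tendsto hlim ?_
      filter_upwards [self_mem_nhdsWithin, mem_nhdsWithin_of_mem_nhds (hnear 0 hu)] with y hy hy'
      have := hball y hy'
      rwa [Function.update_of_ne (ne_of_gt hy)] at this
    · have := hball u hu
      rwa [Function.update_of_ne hu0] at this
  have hleft : ∀ u : I, |(u : ℝ) - t| < ε → Function.leftLim h u ∈ K := by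
    intro u hu
    by_cases hu0 : u = 0
    · subst hu0
      rw [leftLim_zero]
      exact hval 0 hu
    · have : (𝓝[<] u).NeBot :=
        nhdsLT_neBot_of_exists_lt ⟨0, unitInterval.pos_iff_ne_zero.2 hu0⟩
      refine Metric.isClosed_closedBall.mem_of_tendsto (hh.tendsto_leftLim u) ?_
      filter_upwards [mem_nhdsWithin_of_mem_nhds (hnear u hu)] with y hy
      exact hval y hy
  change (WithLp.ofLp p).2 ∈ K
  rcases (hh.mem_modifiedGraph_iff p).1 hp with ⟨s, x, hx, rfl⟩ | ⟨x, hx, rfl⟩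
  · exact (convex_closedBall _ _).segment_subset (hleft s hε) (hval s hε) hx
  · have h0 : |((0 : I) : ℝ) - t| < ε := hε
    have := hball 0 h0
    rw [Function.update_self] at this
    exact (convex_closedBall _ _).segment_subset this (hval 0 h0) hx

end Graph

/-! ### Comparison of the metrics and compactness in bounded variation. -/

section Compactness

variable {d : ℕ}

theorem exists_monotone_of_totalVar_le {h : I → RVec d} {V : ℝ} (hV : 0 ≤ V)
    (hh : totalVar h ≤ ENNReal.ofReal V) :
    ∃ w : ℝ → ℝ, Monotone w ∧ (∀ t, 0 ≤ w t ∧ w t ≤ V) ∧ ∀ x y : I, x ≤ y →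
      dist (Function.update h 0 0 x) (Function.update h 0 0 y) ≤ w y - w x :=
  exists_monotone_dist_le hV ((eVariationOn_update_le_totalVar h).trans hh)

theorem parametrization_one_of_mem_BV {h : I → RVec d} (hh : h ∈ BV d) {γ : I → TimeSpace d}
    (hγ : γ ∈ parametrizations h) : γ 1 = WithLp.toLp 2 ((1 : ℝ), h 1) := by
  obtain ⟨w, hw, -, hd⟩ := exists_monotone_of_totalVar_le (h := h) ENNReal.toReal_nonneg
    (ENNReal.ofReal_toReal hh.2.ne).ge
  exact parametrization_one hh.1 hw hd hγ

/-- If `g` is close to `h` in the metric `rhoOne`, then it is pointwise close to `h` up to an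
increment of the variation of `h`. -/
theorem dist_le_of_rhoOne_lt {h g : I → RVec d} (hh : h ∈ BV d) (hg : g ∈ BV d) {w : ℝ → ℝ}
    (hw : Monotone w) (hd : ∀ x y : I, x ≤ y →
      dist (Function.update h 0 0 x) (Function.update h 0 0 y) ≤ w y - w x)
    {ε : ℝ} (hρ : rhoOne h g < ENNReal.ofReal ε) :
    (∀ t : I, t ≠ 0 → dist (h t) (g t) ≤ ε + (w (t + ε) - w (t - ε))) ∧ dist (h 1) (g 1) ≤ ε := by
  simp only [rhoOne, iInf_lt_iff] at hρ
  obtain ⟨γ₁, h₁, γ₂, h₂, hlt⟩ := hρ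
  have hclose : ∀ s, dist (γ₁ s) (γ₂ s) < ε := by
    intro s
    have hs := (le_iSup (fun s => edist (γ₁ s) (γ₂ s)) s).trans_lt hlt
    rw [edist_dist] at hs
    exact (ENNReal.ofReal_lt_ofReal_iff_of_nonneg dist_nonneg).1 hs
  constructor
  · intro t ht
    obtain ⟨s, -, hs⟩ := h₂.2.1.surjOn (hg.1.mem_modifiedGraph t)
    have hfst := (WithLp.dist_fst_le (γ₁ s) (γ₂ s)).trans_lt (hclose s)
    have hsnd := (WithLp.dist_snd_le (γ₁ s) (γ₂ s)).trans_lt (hclose s)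
    rw [hs, Real.dist_eq] at hfst
    rw [hs] at hsnd
    have h3 := dist_le_of_mem_modifiedGraph hh.1 hw hd (h₁.2.1.mapsTo (mem_univ s)) ht hfst
    rw [dist_comm] at h3
    calc dist (h t) (g t) ≤ dist (h t) (γ₁ s).ofLp.2 + dist (γ₁ s).ofLp.2 (g t) :=
          dist_triangle _ _ _
      _ ≤ ε + (w (t + ε) - w (t - ε)) := by linarith [show dist (γ₁ s).ofLp.2 (g t) < ε from hsnd]
  · have hsnd := (WithLp.dist_snd_le (γ₁ 1) (γ₂ 1)).trans_lt (hclose 1)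
    rw [parametrization_one_of_mem_BV hh h₁, parametrization_one_of_mem_BV hg h₂] at hsnd
    exact hsnd.le

theorem rhoStar_le_of_dist_le {h g : I → RVec d} {v w : ℝ → ℝ} (hv : Monotone v) (hw : Monotone w)
    {V : ℝ} (hV : 0 ≤ V) (hvV : ∀ t, 0 ≤ v t ∧ v t ≤ V) (hwV : ∀ t, 0 ≤ w t ∧ w t ≤ V) {ε : ℝ}
    (hε : 0 ≤ ε) (hd : ∀ t : I, t ≠ 0 → dist (h t) (g t) ≤
      2 * ε + (v (t + ε) - v (t - ε)) + 2 * (w (t + ε) - w (t - ε)))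
    (hd1 : dist (h 1) (g 1) ≤ 2 * ε) : rhoStar h g ≤ ENNReal.ofReal (ε * (4 + 6 * V)) := by
  have hmono : ∀ {v : ℝ → ℝ}, Monotone v → ∀ t : ℝ, 0 ≤ v (t + ε) - v (t - ε) :=
    fun hv t => sub_nonneg.2 (hv (by linarith))
  have hint : ∫⁻ s : I, ‖h s - g s‖ₑ ≤
      ∫⁻ s : I, (ENNReal.ofReal (2 * ε) + ENNReal.ofReal (v (s + ε) - v (s - ε)) +
        ENNReal.ofReal 2 * ENNReal.ofReal (w (s + ε) - w (s - ε))) := by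
    refine lintegral_mono_ae ?_
    have h0 : ∀ᵐ s : I, s ≠ 0 := by simp [ae_iff, measure_singleton]
    filter_upwards [h0] with s hs
    rw [← edist_eq_enorm_sub, edist_dist, ← ENNReal.ofReal_mul zero_le_two,
      ← ENNReal.ofReal_add (by positivity) (hmono hv s),
      ← ENNReal.ofReal_add (add_nonneg (by positivity) (hmono hv s))
        (mul_nonneg zero_le_two (hmono hw s))]
    exact ENNReal.ofReal_le_ofReal (hd s hs)
  have hsum : ∫⁻ s : I, (ENNReal.ofReal (2 * ε) + ENNReal.ofReal (v (s + ε) - v (s - ε)) +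
      ENNReal.ofReal 2 * ENNReal.ofReal (w (s + ε) - w (s - ε))) ≤
      ENNReal.ofReal (2 * ε) + ENNReal.ofReal (2 * ε * V) +
        ENNReal.ofReal 2 * ENNReal.ofReal (2 * ε * V) := by
    rw [lintegral_add_right _ ((measurable_increment hw ε).const_mul _),
      lintegral_add_right _ (measurable_increment hv ε),
      lintegral_const_mul _ (measurable_increment hw ε), lintegral_const, measure_univ, mul_one]
    gcongr
    · exact lintegral_increment_le hv hvV hε
    · exact lintegral_increment_le hw hwV hε
  have hend : ‖h 1 - g 1‖ₑ ≤ ENNReal.ofReal (2 * ε) := by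
    rw [← edist_eq_enorm_sub, edist_dist]
    exact ENNReal.ofReal_le_ofReal hd1
  refine (add_le_add (hint.trans hsum) hend).trans (le_of_eq ?_)
  rw [← ENNReal.ofReal_mul zero_le_two,
    ← ENNReal.ofReal_add (by positivity) (by positivity),
    ← ENNReal.ofReal_add (by positivity) (by positivity),
    ← ENNReal.ofReal_add (by positivity) (by positivity)]
  congr 1
  ring

/-- Paths of uniformly bounded variation starting from the origin converge pointwise along any
ultrafilter. -/
theorem exists_tendsto_of_eVariationOn_le {ι : Type*} (l : Ultrafilter ι) {g : ι → I → RVec d}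
    {V : ℝ} (h0 : ∀ i, g i 0 = 0) (hg : ∀ i, eVariationOn (g i) univ ≤ ENNReal.ofReal V) :
    ∃ f : I → RVec d, eVariationOn f univ ≤ ENNReal.ofReal V ∧
      ∀ x, Tendsto (fun i => g i x) l (𝓝 (f x)) := by
  have hmem : ∀ i x, g i x ∈ Metric.closedEBall (0 : RVec d) (ENNReal.ofReal V) := by
    intro i x
    rw [Metric.mem_closedEBall, ← h0 i]
    exact (eVariationOn.edist_le (g i) (mem_univ x) (mem_univ 0)).trans (hg i)
  have hlim : ∀ x, ∃ y, Tendsto (fun i => g i x) l (𝓝 y) := by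
    intro x
    have hc : IsCompact (Metric.closedEBall (0 : RVec d) (ENNReal.ofReal V)) := by
      rcases le_total 0 V with hV | hV
      · rw [Metric.closedEBall_ofReal hV]
        exact isCompact_closedBall _ _
      · rw [ENNReal.ofReal_of_nonpos hV, Metric.closedEBall_zero]
        exact isCompact_singleton
    obtain ⟨y, -, hy⟩ := hc.ultrafilter_le_nhds (l.map fun i => g i x)
      (le_principal_iff.2 (Ultrafilter.mem_map.2
        (Eventually.of_forall (f := (l : Filter ι)) fun i => hmem i x)))
    exact ⟨y, hy⟩
  choose f hf using hlim
  refine ⟨f, le_of_not_gt fun hlt => ?_, hf⟩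
  obtain ⟨i, hi⟩ := (eVariationOn.lowerSemicontinuous_aux (fun x _ => hf x) hlt).exists
  exact not_lt_of_ge (hg i) hi

/-- Convergence on this finite set is all that is needed: monotone variation bounds transfer it to
every other time. -/
theorem exists_finset_right_approx {δ : ℝ} (hδ : 0 < δ) :
    ∃ Y : Finset I, 1 ∈ Y ∧ ∀ x : I, x < 1 → ∃ y ∈ Y, x < y ∧ (y : ℝ) ≤ x + δ := by
  classical
  obtain ⟨n, hn⟩ := exists_nat_one_div_lt hδ
  have hm : (0 : ℝ) < n + 1 := by positivity
  have hp : ∀ k : ℕ, min ((k : ℝ) / (n + 1)) 1 ∈ Icc (0 : ℝ) 1 := fun k =>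
    ⟨le_min (by positivity) zero_le_one, min_le_right _ _⟩
  refine ⟨insert 1 ((Finset.range (n + 2)).image fun k => ⟨_, hp k⟩), Finset.mem_insert_self _ _,
    fun x hx => ?_⟩
  have hx1 : (x : ℝ) < 1 := hx
  have hx0 : 0 ≤ (x : ℝ) * (n + 1) := mul_nonneg x.2.1 hm.le
  set k := ⌊(x : ℝ) * (n + 1)⌋₊ with hk
  have hk1 : (k : ℝ) ≤ x * (n + 1) := Nat.floor_le hx0
  have hk2 : (x : ℝ) * (n + 1) < k + 1 := Nat.lt_floor_add_one _
  have hkn : k < n + 1 := by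
    have : (k : ℝ) < ((n + 1 : ℕ) : ℝ) := by push_cast; nlinarith
    exact_mod_cast this
  refine ⟨⟨_, hp (k + 1)⟩, Finset.mem_insert_of_mem
    (Finset.mem_image_of_mem _ (Finset.mem_range.2 (by omega))), ?_, ?_⟩
  · change (x : ℝ) < min (((k + 1 : ℕ) : ℝ) / (n + 1)) 1
    refine lt_min ?_ hx1
    rw [lt_div_iff₀ hm]
    push_cast
    exact hk2
  · refine (min_le_left _ _).trans ?_
    have h1 : (((k + 1 : ℕ) : ℝ) / (n + 1)) = k / (n + 1) + 1 / (n + 1) := by push_cast; ring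
    have h2 : (k : ℝ) / (n + 1) ≤ x := (div_le_iff₀ hm).2 hk1
    rw [h1]
    linarith

theorem isCadlag_rightLim {f : I → RVec d} (hf : BoundedVariationOn f univ) :
    IsCadlag f.rightLim := fun t =>
  ⟨hf.continuousWithinAt_rightLim, _, hf.rightLim.tendsto_leftLim t⟩

theorem dist_rightLim_le {f : I → RVec d} (hf : BoundedVariationOn f univ) {w : ℝ → ℝ}
    (hw : Monotone w) (hd : ∀ x y : I, x ≤ y → dist (f x) (f y) ≤ w y - w x) {x y : I}
    (hxy : x < y) : dist (f.rightLim x) (f y) ≤ w y - w x := by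
  have : (𝓝[>] x).NeBot := nhdsGT_neBot_of_exists_gt ⟨y, hxy⟩
  refine le_of_tendsto ((hf.tendsto_rightLim x).dist tendsto_const_nhds) ?_
  filter_upwards [Ioo_mem_nhdsGT hxy] with z hz
  have : w x ≤ w z := hw hz.1.le
  linarith [hd z y hz.2.le]

end Compactness

/-! ### Limits of near-minimizers and the conclusion. -/

section Main

variable {d : ℕ} {Ω : Type*} [MeasurableSpace Ω] {P : Measure Ω} {X : Ω → RVec d}

/-- If the rate functional is at most `c`, up to arbitrarily small errors, arbitrarily close to `B`
in the metric `rhoOne`, then it is at most `c` somewhere in the `rhoStar`-closure of `B`. -/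
theorem exists_mem_closureBV_pathRate_le (hCramer : (0 : RVec d) ∈ interior (laplaceDomain P X))
    {B : Set (I → RVec d)} (hB : B ⊆ BV d) {c : ℝ≥0∞} (hc : c < ⊤)
    (hinf : ∀ ε : ℝ, 0 < ε → ⨅ h ∈ nbhdBV rhoOne B ε, pathRate P X h ≤ c) :
    ∃ h ∈ closureBV rhoStar B, pathRate P X h ≤ c := by
  have hsel : ∀ n : ℕ, ∃ h ∈ nbhdBV rhoOne B (1 / ((n : ℝ) + 1)),
      pathRate P X h < c + ((n : ℝ≥0∞) + 1)⁻¹ := by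
    intro n
    have hlt : c < c + ((n : ℝ≥0∞) + 1)⁻¹ :=
      ENNReal.lt_add_right hc.ne (by simp)
    have := (hinf (1 / ((n : ℝ) + 1)) Nat.one_div_pos_of_nat).trans_lt hlt
    simpa only [iInf_lt_iff, exists_prop] using this
  choose k hk hkr using hsel
  choose hkBV g hgB hkg using hk
  obtain ⟨a, b, ha, hb, hab⟩ := exists_linear_le_cramerRate hCramer
  set V : ℝ := a * ((c.toReal + 1) + b) with hVdef
  have hV : 0 ≤ V := by positivity
  have hbound : ∀ h, pathRate P X h ≤ c + 1 → totalVar h ≤ ENNReal.ofReal V := by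
    intro h hh
    refine (totalVar_le_pathRate hab h).trans ?_
    rw [hVdef, ENNReal.ofReal_mul ha, ENNReal.ofReal_add (by positivity) hb,
      ENNReal.ofReal_add (by positivity) zero_le_one, ENNReal.ofReal_toReal hc.ne,
      ENNReal.ofReal_one]
    gcongr
  have hkV : ∀ n, totalVar (k n) ≤ ENNReal.ofReal V := by
    intro n
    refine hbound _ ((hkr n).le.trans ?_)
    gcongr
    rw [ENNReal.inv_le_one]
    exact le_add_self
  set u : ℕ → I → RVec d := fun n => Function.update (k n) 0 0 with hu
  set l : Ultrafilter ℕ := hyperfilter ℕ with hl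
  obtain ⟨f, hfV, hf⟩ := exists_tendsto_of_eVariationOn_le l (g := u) (V := V)
    (fun n => Function.update_self _ _ _)
    (fun n => (eVariationOn_update_le_totalVar (k n)).trans (hkV n))
  have hfBV : BoundedVariationOn f univ := (hfV.trans_lt ENNReal.ofReal_lt_top).ne
  have h1 : f.rightLim 1 = f 1 := rightLim_eq_of_isTop fun _ => unitInterval.le_one'
  -- Used twice: with the norm, to put the limit in `BV d`, and with the rate function, to bound its
  -- rate.
  have hlsc : ∀ {F : RVec d → ℝ≥0∞} {C : ℝ≥0∞}, LowerSemicontinuous F →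
      (∀ᶠ n in l, slopeFunctional F (k n) ≤ C) → slopeFunctional F f.rightLim ≤ C := by
    intro F C hF hC
    refine slopeFunctional_le_of_tendsto hF (fun x _ => hf x)
      (fun x _ _ => hfBV.tendsto_rightLim x) h1 ?_
    simpa only [hu, slopeFunctional_update] using hC
  have hhV : totalVar f.rightLim ≤ ENNReal.ofReal V :=
    hlsc (F := fun v => ‖v‖ₑ) continuous_enorm.lowerSemicontinuous (Eventually.of_forall hkV)
  have hhBV : f.rightLim ∈ BV d :=
    ⟨isCadlag_rightLim hfBV, hhV.trans_lt ENNReal.ofReal_lt_top⟩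
  refine ⟨f.rightLim, ⟨hhBV, fun η hη => ?_⟩, ?_⟩
  · set ε : ℝ := η / (5 + 6 * V) with hε
    have hε0 : 0 < ε := by positivity
    obtain ⟨Y, hY1, hY⟩ := exists_finset_right_approx hε0
    obtain ⟨v, hv, hvV, hvd⟩ := exists_monotone_dist_le hV hfV
    have hev : ∀ᶠ n in (l : Filter ℕ), (∀ y ∈ Y, dist (u n y) (f y) < ε) ∧
        1 / ((n : ℝ) + 1) < ε := by
      refine ((Filter.eventually_all_finset _).2 fun y _ =>
        Metric.tendsto_nhds.1 (hf y) ε hε0).and ?_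
      exact Nat.hyperfilter_le_atTop
        (tendsto_one_div_add_atTop_nhds_zero_nat.eventually_lt_const hε0)
    obtain ⟨n, hnY, hnε⟩ := hev.exists
    obtain ⟨w, hw, hwV, hwd⟩ := exists_monotone_of_totalVar_le hV (hkV n)
    obtain ⟨hclose, hclose1⟩ := dist_le_of_rhoOne_lt (hkBV n) (hB (hgB n)) hw hwd
      ((hkg n).trans_le (ENNReal.ofReal_le_ofReal hnε.le))
    have hun : ∀ t : I, t ≠ 0 → u n t = k n t := fun t ht => Function.update_of_ne ht _ _
    have hd1 : dist (f.rightLim 1) (g n 1) ≤ 2 * ε := by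
      have e1 := hnY 1 hY1
      rw [hun 1 one_ne_zero, dist_comm] at e1
      rw [h1]
      linarith [dist_triangle (f 1) (k n 1) (g n 1)]
    refine ⟨g n, hgB n, (rhoStar_le_of_dist_le hv hw hV hvV hwV hε0.le ?_ hd1).trans_lt ?_⟩
    · intro t ht
      have hvt : v (t - ε) ≤ v t := hv (by linarith)
      have hwt : w (t - ε) ≤ w t := hw (by linarith)
      rcases (unitInterval.le_one' (t := t)).eq_or_lt with rfl | ht1
      · have hvt' : v ((1 : I) : ℝ) ≤ v ((1 : I) + ε) := hv (by linarith)
        have hwt' : w ((1 : I) : ℝ) ≤ w ((1 : I) + ε) := hw (by linarith)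
        linarith
      -- The chain is `f.rightLim t`, `f y`, `k n y`, `k n t`, `g n t`. It costs an increment of
      -- `v`, then `ε`, then an increment of `w`, then `ε` plus another increment of `w`.
      · obtain ⟨y, hyY, hty, hyt⟩ := hY t ht1
        have hvy : v y ≤ v (t + ε) := hv hyt
        have hwy : w y ≤ w (t + ε) := hw hyt
        have e1 := dist_rightLim_le hfBV hv hvd hty
        have e2 := hnY y hyY
        have e3 : dist (u n t) (u n y) ≤ w y - w t := hwd t y hty.le
        have e4 := hclose t ht
        rw [hun t ht] at e3
        rw [dist_comm] at e2 e3
        have e5 := dist_triangle4 (f.rightLim t) (f y) (u n y) (k n t)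
        have e6 := dist_triangle (f.rightLim t) (k n t) (g n t)
        linarith
    · refine (ENNReal.ofReal_lt_ofReal_iff hη).2 ?_
      rw [hε, div_mul_eq_mul_div, div_lt_iff₀ (by positivity)]
      exact mul_lt_mul_of_pos_left (by linarith) hη
  · refine le_of_forall_gt_imp_ge_of_dense fun C hC => ?_
    refine hlsc (lowerSemicontinuous_cramerRate P X) ?_
    have hlim : Tendsto (fun n : ℕ => c + ((n : ℝ≥0∞) + 1)⁻¹) atTop (𝓝 c) := by
      have h0 : Tendsto (fun n : ℕ => (((n + 1 : ℕ) : ℝ≥0∞))⁻¹) atTop (𝓝 0) :=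
        ENNReal.tendsto_inv_nat_nhds_zero.comp (tendsto_add_atTop_nat 1)
      simpa using (tendsto_const_nhds (x := c)).add h0
    filter_upwards [Nat.hyperfilter_le_atTop (hlim.eventually_lt_const hC)] with n hn
    exact (hkr n).le.trans (le_of_lt hn)

theorem rhoStar_self (h : I → RVec d) : rhoStar h h = 0 := by simp [rhoStar]

end Main

theorem proposition4p3 {d : ℕ} (hd : 1 ≤ d) {Ω : Type*} [MeasurableSpace Ω]
    (P : Measure Ω) [IsProbabilityMeasure P] (X : Ω → RVec d) (hX : Measurable X)
    (hCramer : (0 : RVec d) ∈ interior (laplaceDomain P X))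
    (B : Set (I → RVec d)) (hB : B ⊆ BV d)
    (hcl : closureBV rhoOne B = closureBV rhoStar B) :
    Tendsto (fun ε : ℝ => ⨅ h ∈ nbhdBV rhoOne B ε, pathRate P X h) (𝓝[>] 0)
        (𝓝 (⨅ h ∈ closureBV rhoOne B, pathRate P X h)) ∧
      (B.Nonempty → ∃ h ∈ closureBV rhoOne B,
        pathRate P X h = ⨅ g ∈ closureBV rhoOne B, pathRate P X g) := by
  have hle : ∀ ε : ℝ, 0 < ε → ⨅ h ∈ nbhdBV rhoOne B ε, pathRate P X h ≤
      ⨅ h ∈ closureBV rhoOne B, pathRate P X h := fun ε hε =>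
    biInf_mono fun h hh => ⟨hh.1, hh.2 ε hε⟩
  have hanti : ∀ ε δ : ℝ, ε ≤ δ → ⨅ h ∈ nbhdBV rhoOne B δ, pathRate P X h ≤
      ⨅ h ∈ nbhdBV rhoOne B ε, pathRate P X h := fun ε δ hεδ =>
    biInf_mono fun h ⟨hh, g, hg, hlt⟩ =>
      ⟨hh, g, hg, hlt.trans_le (ENNReal.ofReal_le_ofReal hεδ)⟩
  refine ⟨tendsto_order.2 ⟨fun c hc => ?_, fun c hc => ?_⟩, fun ⟨g, hg⟩ => ?_⟩
  · by_contra hcon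
    have hinf : ∀ ε : ℝ, 0 < ε → ⨅ h ∈ nbhdBV rhoOne B ε, pathRate P X h ≤ c := by
      intro ε hε
      by_contra! hlt
      refine hcon ?_
      -- The infimum grows as the radius shrinks, so exceeding `c` at one radius means exceeding it
      -- at all smaller ones.
      filter_upwards [Ioc_mem_nhdsGT hε] with δ hδ
      exact hlt.trans_le (hanti δ ε hδ.2)
    obtain ⟨h, hh, hhc⟩ := exists_mem_closureBV_pathRate_le hCramer hB hc.lt_top hinf
    rw [← hcl] at hh
    exact not_lt_of_ge ((iInf₂_le h hh).trans hhc) hc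
  · filter_upwards [self_mem_nhdsWithin] with ε hε
    exact (hle ε hε).trans_lt hc
  · rcases eq_or_ne (⨅ g ∈ closureBV rhoOne B, pathRate P X g) ⊤ with htop | hne
    -- Membership is checked in the `rhoStar` closure: a zero `rhoOne` self-distance would require a
    -- parametrization to exist.
    · have hgc : g ∈ closureBV rhoOne B := by
        rw [hcl]
        exact ⟨hB hg, fun ε hε => ⟨g, hg, by rw [rhoStar_self]; exact ENNReal.ofReal_pos.2 hε⟩⟩
      refine ⟨g, hgc, le_antisymm ?_ (iInf₂_le g hgc)⟩
      rw [htop]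
      exact le_top
    · obtain ⟨h, hh, hhc⟩ := exists_mem_closureBV_pathRate_le hCramer hB hne.lt_top hle
      rw [← hcl] at hh
      exact ⟨h, hh, le_antisymm hhc (iInf₂_le h hh)⟩
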